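/- Let $K$ be a number field whose ring of integers $\mathcal{O}_K$ is principal. Denote also by $\mathcal{O}_K$ the small category with a single object $\star$, whose arrows are the elements of the ring $\mathcal{O}_K$, composed by multiplication. Let $\widehat{\mathcal{O}_K}$ be the topos of presheaves on it, i.e. of contravariant functors to $\mathfrak{Sets}$. A (geometric) point of $\widehat{\mathcal{O}_K}$ is a geometric morphism $p:\mathfrak{Sets}\to\widehat{\mathcal{O}_K}$, i.e. a functor $p_*:\mathfrak{Sets}\to\widehat{\mathcal{O}_K}$ with a left adjoint $p^*$ that preserves finite limits; a morphism of points $p\to q$ is a natural transformation $p^*\to q^*$. A covariant functor $F:\mathcal{C}\to\mathfrak{Sets}$ is flat (filtering) if: (i) $F(C)\neq\emptyset$ for some object $C$; (ii) for all $a\in F(A)$, $b\in F(B)$ there are arrows $u:Z\to A$, $v:Z\to B$ and $z\in F(Z)$ with $F(u)z=a$, $F(v)z=b$; (iii) for all $u,v:A\to B$ and $a\in F(A)$ with $F(u)a=F(v)a$ there are $w:Z\to A$ and $z\in F(Z)$ with $F(w)z=a$ and $u\circ w=v\circ w$. (1) For every flat covariant functor $F:\mathcal{O}_K\to\mathfrak{Sets}$,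 there is exactly one $\mathcal{O}_K$-module structure on the set $F(\star)$ such that $\lambda x=F(\lambda)(x)$ for all $\lambda\in\mathcal{O}_K$ and $x\in F(\star)$. With this structure, $F(\star)$ is isomorphic to a sub-$\mathcal{O}_K$-module of $K$. For every natural transformation $\Phi:F\to G$ between flat functors, the map $\Phi_\star:F(\star)\to G(\star)$ is $\mathcal{O}_K$-linear. (2) The category of geometric points of $\widehat{\mathcal{O}_K}$ is canonically equivalent to the category whose objects are the sub-$\mathcal{O}_K$-modules $H$ of $K$ and whose morphisms are all $\mathcal{O}_K$-linear maps. Canonically means the following. For a sub-$\mathcal{O}_K$-module $H$ of $K$, let $F_H:\mathcal{O}_K\to\mathfrak{Sets}$ be the functor with $F_H(\star)=H$ on which $\lambda\in\mathcal{O}_K$ acts as multiplication by $\lambda$. For a point $p$, let $F_p=p^*\circ y$, where $y:\mathcal{O}_K\to\widehat{\mathcal{O}_K}$ is the Yoneda embedding. There is an equivalence $p\mapsto H_p$ of these categories together with an isomorphism $F_{H_p}\cong F_p$ that is natural in the point $p$. -/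

import Mathlib

open CategoryTheory CategoryTheory.Limits
open scoped NumberField

universe u v w v₁ v₂ u₁ u₂

namespace ArithTopos

/-- A geometric morphism `E → F` between categories (in practice: topoi): a direct image functor
`f_* : E ⥤ F` with a left adjoint `f^* : F ⥤ E`, the inverse image, that preserves finite limits. -/
structure GeometricMorphism (E : Type u₁) [Category.{v₁} E] (F : Type u₂) [Category.{v₂} F] where
  directImage : E ⥤ F
  inverseImage : F ⥤ E
  adj : inverseImage ⊣ directImage
  preservesFiniteLimits : PreservesFiniteLimits inverseImage

/-- A morphism of geometric morphisms `f ⟶ g` is a natural transformation `f^* ⟶ g^*`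
between the inverse image functors. -/
@[ext]
structure GeometricMorphism.Hom {E : Type u₁} [Category.{v₁} E] {F : Type u₂} [Category.{v₂} F]
    (f g : GeometricMorphism E F) where
  natTrans : f.inverseImage ⟶ g.inverseImage

instance {E : Type u₁} [Category.{v₁} E] {F : Type u₂} [Category.{v₂} F] :
    Category (GeometricMorphism E F) where
  Hom f g := GeometricMorphism.Hom f g
  id f := ⟨𝟙 f.inverseImage⟩
  comp a b := ⟨a.natTrans ≫ b.natTrans⟩

/-- The presheaf topos on `C`: the contravariant functors from `C` to sets. -/
abbrev PresheafTopos (C : Type v) [Category.{u} C] := Cᵒᵖ ⥤ Type u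

/-- The category of geometric points of the presheaf topos on `C`: the geometric morphisms from
the topos of sets to it. -/
abbrev Points (C : Type v) [Category.{u} C] :=
  GeometricMorphism (Type u) (PresheafTopos.{u} C)

/-- The covariant functor `C ⥤ Sets` attached to a point `p` of the presheaf topos on `C`: the
restriction of the inverse image `p^*` to the representable presheaves. -/
def Points.toFunctor (C : Type v) [Category.{u} C] : Points.{u} C ⥤ (C ⥤ Type u) where
  obj p := yoneda ⋙ p.inverseImage
  map φ := Functor.whiskerLeft yoneda φ.natTrans

/-- Flat (that is, filtering) covariant functors from a category to sets. -/
structure IsFlat {C : Type v} [Category.{u} C] (F : C ⥤ Type w) : Prop where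
  nonempty : ∃ A : C, Nonempty (F.obj A)
  exists_common : ∀ (A B : C) (a : F.obj A) (b : F.obj B),
    ∃ (Z : C) (p : Z ⟶ A) (q : Z ⟶ B) (z : F.obj Z), F.map p z = a ∧ F.map q z = b
  exists_equalizing : ∀ (A B : C) (p q : A ⟶ B) (a : F.obj A), F.map p a = F.map q a →
    ∃ (Z : C) (r : Z ⟶ A) (z : F.obj Z), F.map r z = a ∧ r ≫ p = r ≫ q

/-- The arrow of the one-object category of the multiplicative monoid of `R` indexed by `r`. -/
def arrow {R : Type u} [Monoid R] (r : R) : SingleObj.star R ⟶ SingleObj.star R := r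

/-- An `R`-module structure on the set `F(⋆)` whose scalar multiplication by `r` is the map `F(r)`,
for a functor `F` from the one-object category of the multiplicative monoid of `R` to sets. -/
structure ModuleStructure {R : Type u} [Ring R] (F : SingleObj R ⥤ Type w) where
  addCommGroup : AddCommGroup (F.obj (SingleObj.star R))
  module : Module R (F.obj (SingleObj.star R))
  smul_eq : ∀ (r : R) (x : F.obj (SingleObj.star R)), r • x = F.map (arrow r) x

/-- The set `F(⋆)`, as the `R`-module given by a module structure on it. -/
def ModuleStructure.toModuleCat {R : Type u} [Ring R] {F : SingleObj R ⥤ Type w}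
    (M : ModuleStructure F) : ModuleCat.{w} R :=
  letI := M.addCommGroup
  letI := M.module
  ModuleCat.of R (F.obj (SingleObj.star R))

/-- The category of the sub-`R`-modules of `M`, with all `R`-linear maps `H → H'` as
morphisms (not only the inclusions). -/
abbrev SubmoduleCat (R : Type u) [Ring R] (M : Type w) [AddCommGroup M] [Module R M] :=
  InducedCategory (ModuleCat.{w} R) (fun H : Submodule R M => ModuleCat.of R H)

/-- The functor sending a sub-`R`-module `H` of `M` to the functor `F_H` with `F_H(⋆) = H`, on which
the arrow `r` acts as the multiplication by `r`. -/
def SubmoduleCat.toFunctor (R : Type u) [Ring R] (M : Type w) [AddCommGroup M] [Module R M] :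
    SubmoduleCat R M ⥤ (SingleObj R ⥤ Type w) where
  obj H := actionAsFunctor R (H : Submodule R M)
  map {H H'} φ :=
    { app := fun _ => ↾(fun x => φ.hom.hom x)
      naturality := fun _ _ r => by
        ext x
        exact φ.hom.hom.map_smul (show R from r) x }

end ArithTopos

/-!
Both categories are identified with that of the flat functors on the one-object category.

For the points this is Diaconescu's theorem, valid for every small category `C`. The inverse image
of a point is cocontinuous, hence is the left Kan extension of its restriction to the representables
(`Points.isLeftKanExtension`), so that restriction is fully faithful; the restriction is flat
(`Points.isFlat`) because the inverse image preserves finite limits and every presheaf is covered by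
representables. Conversely a flat functor has a cofiltered category of elements, so the filtered
colimit over it defines a point (`IsFlat.point`).

For the submodules, let `R` be a domain with fraction field `K` and let `F` be flat on its
multiplicative monoid. Any two elements of `F(⋆)` are multiples `p • z`, `q • z` of a third one, so
a compatible addition is forced, `p • z + q • z = (p + q) • z`, and equivariant maps are additive
(`ModuleStructure.map_add_of_equivariant`). If `a₀` is a nonzero element, then writing `a₀ = p • z`,
`a = q • z` and sending `a` to `q / p` embeds `F(⋆)` equivariantly in `K`, with range a submodule
(`IsFlat.exists_iso_submodule`); the module structure is pulled back from there. Conversely, when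
ideals with two generators are principal, any two elements of a submodule of `K` are multiples of a
third, and its functor is flat (`SubmoduleCat.isFlat`).
-/

namespace ArithTopos

/-! ### Points of a presheaf topos as flat functors -/

section Points

variable {C : Type v} [Category.{u} C]

/-- As every presheaf `P` is a colimit of representables, a cocontinuous functor `L` to sets has
each `L(P)` covered by the images of the `L(yoneda A)`. -/
lemma exists_map_yoneda_eq (L : PresheafTopos.{u} C ⥤ Type u)
    [PreservesColimitsOfSize.{u, max u v} L] (P : PresheafTopos.{u} C) (s : L.obj P) :
    ∃ (A : C) (f : yoneda.obj A ⟶ P) (t : L.obj (yoneda.obj A)), L.map f t = s := by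
  obtain ⟨j, t, ht⟩ := Types.jointly_surjective_of_isColimit
    (isColimitOfPreserves L (Presheaf.isColimitTautologicalCocone P)) s
  exact ⟨j.left, j.hom, t, ht⟩

/-- The limits witnessing flatness (the terminal object, binary products, equalizers) exist in the
presheaf topos and are preserved by `p^*`; an element of `p^*` of such a limit lifts to an element
of `p^*` of a representable presheaf over it. -/
theorem Points.isFlat (p : Points.{u} C) : IsFlat ((Points.toFunctor C).obj p) := by
  have := p.preservesFiniteLimits
  have : PreservesColimitsOfSize.{u, max u v} p.inverseImage := p.adj.leftAdjoint_preservesColimits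
  let L := p.inverseImage
  refine ⟨?_, fun A B a b => ?_, fun A B f g a h => ?_⟩
  · obtain ⟨A, -, t, -⟩ := exists_map_yoneda_eq L (⊤_ _)
      ((terminalIsTerminal.isTerminalObj L).from PUnit .unit)
    exact ⟨A, ⟨t⟩⟩
  · change L.obj (yoneda.obj A) at a
    change L.obj (yoneda.obj B) at b
    let h := mapIsLimitOfPreservesOfIsLimit L _ _ (prodIsProd (yoneda.obj A) (yoneda.obj B))
    let h' := Types.binaryProductLimit (L.obj (yoneda.obj A)) (L.obj (yoneda.obj B))
    obtain ⟨Z, f, z, hz⟩ := exists_map_yoneda_eq L (yoneda.obj A ⨯ yoneda.obj B)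
      ((h'.conePointUniqueUpToIso h).hom ⟨a, b⟩)
    have h₁ : L.map prod.fst ((h'.conePointUniqueUpToIso h).hom ⟨a, b⟩) = a :=
      ConcreteCategory.congr_hom (h'.conePointUniqueUpToIso_hom_comp h (.mk .left)) ⟨a, b⟩
    have h₂ : L.map prod.snd ((h'.conePointUniqueUpToIso h).hom ⟨a, b⟩) = b :=
      ConcreteCategory.congr_hom (h'.conePointUniqueUpToIso_hom_comp h (.mk .right)) ⟨a, b⟩
    rw [← hz, ← Functor.map_comp_apply] at h₁ h₂
    refine ⟨Z, yoneda.preimage (f ≫ prod.fst), yoneda.preimage (f ≫ prod.snd), z, ?_, ?_⟩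
    · change L.map (yoneda.map _) z = a
      rwa [Functor.map_preimage]
    · change L.map (yoneda.map _) z = b
      rwa [Functor.map_preimage]
  · change L.obj (yoneda.obj A) at a
    let k := isLimitForkMapOfIsLimit L _ (equalizerIsEqualizer (yoneda.map f) (yoneda.map g))
    let k' := (Types.equalizerLimit (g := L.map (yoneda.map f)) (h := L.map (yoneda.map g))).isLimit
    obtain ⟨Z, r, z, hz⟩ := exists_map_yoneda_eq L (equalizer (yoneda.map f) (yoneda.map g))
      ((k'.conePointUniqueUpToIso k).hom ⟨a, h⟩)
    have h₁ : L.map (equalizer.ι _ _) ((k'.conePointUniqueUpToIso k).hom ⟨a, h⟩) = a :=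
      ConcreteCategory.congr_hom (k'.conePointUniqueUpToIso_hom_comp k .zero) ⟨a, h⟩
    rw [← hz, ← Functor.map_comp_apply] at h₁
    refine ⟨Z, yoneda.preimage (r ≫ equalizer.ι _ _), z, ?_, yoneda.map_injective ?_⟩
    · change L.map (yoneda.map _) z = a
      rwa [Functor.map_preimage]
    · simp only [Functor.map_comp, Functor.map_preimage, Category.assoc]
      rw [equalizer.condition]

/-- The inverse image of a point is the left Kan extension, along the Yoneda embedding, of its
restriction to the representable presheaves. -/
theorem Points.isLeftKanExtension (p : Points.{u} C) :
    p.inverseImage.IsLeftKanExtension (𝟙 (yoneda ⋙ p.inverseImage)) := by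
  have : PreservesColimitsOfSize.{u, max u v} p.inverseImage := p.adj.leftAdjoint_preservesColimits
  refine Functor.LeftExtension.IsPointwiseLeftKanExtension.isLeftKanExtension
    (E := Functor.LeftExtension.mk _ (𝟙 (yoneda ⋙ p.inverseImage))) fun P => ?_
  exact IsColimit.ofIsoColimit
    (isColimitOfPreserves p.inverseImage (Presheaf.isColimitTautologicalCocone P))
    (Cocone.ext (Iso.refl _) fun j => (Category.comp_id _).trans (Category.id_comp _).symm)

lemma Points.toFunctor_map_bijective (p q : Points.{u} C) :
    Function.Bijective ((Points.toFunctor C).map : (p ⟶ q) → _) := by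
  have := p.isLeftKanExtension
  let e := p.inverseImage.homEquivOfIsLeftKanExtension (𝟙 (yoneda ⋙ p.inverseImage)) q.inverseImage
  have he (β : p.inverseImage ⟶ q.inverseImage) : e β = Functor.whiskerLeft yoneda β := by
    simp [e, Functor.homEquivOfIsLeftKanExtension]
  constructor
  · intro φ ψ h
    refine GeometricMorphism.Hom.ext (e.injective ?_)
    rw [he, he]
    exact h
  · intro α
    exact ⟨⟨e.symm α⟩, (he _).symm.trans (e.apply_symm_apply α)⟩

instance : (Points.toFunctor.{u} C).Faithful :=
  ⟨fun h => (Points.toFunctor_map_bijective _ _).1 h⟩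

instance : (Points.toFunctor.{u} C).Full :=
  ⟨fun α => (Points.toFunctor_map_bijective _ _).2 α⟩

lemma IsFlat.isCofiltered_elements {F : C ⥤ Type w} (hF : IsFlat F) :
    IsCofiltered F.Elements where
  nonempty := let ⟨A, ⟨a⟩⟩ := hF.nonempty; ⟨⟨A, a⟩⟩
  cone_objs := by
    rintro ⟨A, a⟩ ⟨B, b⟩
    obtain ⟨Z, p, q, z, hp, hq⟩ := hF.exists_common A B a b
    exact ⟨⟨Z, z⟩, ⟨p, hp⟩, ⟨q, hq⟩, trivial⟩
  cone_maps := by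
    rintro ⟨A, a⟩ ⟨B, b⟩ ⟨f, hf⟩ ⟨g, hg⟩
    obtain ⟨Z, r, z, hr, h⟩ := hF.exists_equalizing A B f g a (hf.trans hg.symm)
    exact ⟨⟨Z, z⟩, ⟨r, hr⟩, Subtype.ext h⟩

end Points

section Diaconescu

variable {C : Type v} [Category.{u} C] [Small.{u} C]

instance (F : C ⥤ Type u) : InitiallySmall.{u} F.Elements :=
  have : Small.{u} F.Elements := inferInstanceAs (Small.{u} (Σ c : C, F.obj c))
  have : EssentiallySmall.{u} F.Elements := essentiallySmall_of_small_of_locallySmall _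
  initiallySmall_of_essentiallySmall _

/-- A flat functor, as a point of the site with the trivial topology, whose sheaves are all
presheaves. -/
noncomputable def IsFlat.sitePoint {F : C ⥤ Type u} (hF : IsFlat F) :
    GrothendieckTopology.Point.{u} (⊥ : GrothendieckTopology C) where
  fiber := F
  isCofiltered := hF.isCofiltered_elements
  jointly_surjective {U} R hR x := by
    obtain rfl : R = ⊤ := by simpa using hR
    exact ⟨U, 𝟙 _, by simp, x, by simp⟩

/-- The point attached to a flat functor `F`: its inverse image sends a presheaf `P` to the colimit
of the sets `P(A)` over the pairs `(A, a)` with `a ∈ F(A)`. This colimit is filtered, hence commutes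
with finite limits. -/
noncomputable def IsFlat.point {F : C ⥤ Type u} (hF : IsFlat F) : Points.{u} C where
  directImage := hF.sitePoint.skyscraperPresheafFunctor
  inverseImage := hF.sitePoint.presheafFiber
  adj := hF.sitePoint.skyscraperPresheafAdjunction
  preservesFiniteLimits := inferInstance

/-- A flat functor is recovered from its point by restriction to the representables. -/
noncomputable def IsFlat.toFunctorPointIso {F : C ⥤ Type u} (hF : IsFlat F) :
    (Points.toFunctor C).obj hF.point ≅ F :=
  Functor.isoWhiskerRight shrinkYonedaIsoYoneda.symm _ ≪≫
    hF.sitePoint.shrinkYonedaCompPresheafFiberIso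

/-- The flat functors, as a property of the objects of the functor category. -/
abbrev flatFunctors (C : Type v) [Category.{u} C] : ObjectProperty (C ⥤ Type w) := IsFlat

/-- Diaconescu's theorem for points: they are the flat functors. -/
instance : ((flatFunctors C).lift (Points.toFunctor.{u} C) Points.isFlat).IsEquivalence where
  faithful := inferInstance
  full := inferInstance
  essSurj := ⟨fun F => ⟨F.property.point,
    ⟨(flatFunctors C).ι.preimageIso F.property.toFunctorPointIso⟩⟩⟩

end Diaconescu

/-! ### Flat functors on the multiplicative monoid of a ring -/

section Ring

variable {R : Type u} [CommRing R]

lemma map_arrow_mul (F : SingleObj R ⥤ Type w) (r s : R) (x : F.obj (SingleObj.star R)) :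
    F.map (arrow (r * s)) x = F.map (arrow r) (F.map (arrow s) x) :=
  Functor.map_comp_apply F (arrow s) (arrow r) x

lemma IsFlat.exists_common_arrow {F : SingleObj R ⥤ Type w} (hF : IsFlat F)
    (a b : F.obj (SingleObj.star R)) :
    ∃ (p q : R) (z : F.obj (SingleObj.star R)), F.map (arrow p) z = a ∧ F.map (arrow q) z = b :=
  let ⟨_, p, q, z, h⟩ := hF.exists_common _ _ a b
  ⟨p, q, z, h⟩

lemma IsFlat.exists_equalizing_arrow {F : SingleObj R ⥤ Type w} (hF : IsFlat F)
    {p q : R} {a : F.obj (SingleObj.star R)} (h : F.map (arrow p) a = F.map (arrow q) a) :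
    ∃ (r : R) (z : F.obj (SingleObj.star R)), F.map (arrow r) z = a ∧ p * r = q * r :=
  let ⟨_, r, z, hz, h⟩ := hF.exists_equalizing _ _ (arrow p) (arrow q) a h
  ⟨r, z, hz, h⟩

namespace ModuleStructure

/-- In a flat functor any two elements are multiples `p • z`, `q • z` of one element, hence their
sum has to be `(p + q) • z`: an equivariant map out of a flat functor is additive. -/
lemma map_add_of_equivariant {F G : SingleObj R ⥤ Type w} (hF : IsFlat F) (φ : F ⟶ G)
    (M : ModuleStructure F) (N : ModuleStructure G) (a b : F.obj (SingleObj.star R)) :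
    φ.app _ (M.addCommGroup.add a b) = N.addCommGroup.add (φ.app _ a) (φ.app _ b) := by
  let := M.addCommGroup
  let := M.module
  let := N.addCommGroup
  let := N.module
  obtain ⟨p, q, z, rfl, rfl⟩ := hF.exists_common_arrow a b
  change φ.app (SingleObj.star R) (_ + _) =
    φ.app (SingleObj.star R) _ + φ.app (SingleObj.star R) _
  rw [← M.smul_eq, ← M.smul_eq, ← add_smul, M.smul_eq, M.smul_eq, M.smul_eq,
    NatTrans.naturality_apply, NatTrans.naturality_apply, NatTrans.naturality_apply,
    ← N.smul_eq, ← N.smul_eq, ← N.smul_eq, add_smul]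

/-- A natural transformation out of a flat functor, as a linear map. -/
def homOfNatTrans {F G : SingleObj R ⥤ Type w} (hF : IsFlat F) (φ : F ⟶ G)
    (M : ModuleStructure F) (N : ModuleStructure G) : M.toModuleCat ⟶ N.toModuleCat :=
  letI := M.addCommGroup
  letI := M.module
  letI := N.addCommGroup
  letI := N.module
  ModuleCat.ofHom
    { toFun := φ.app (SingleObj.star R)
      map_add' := map_add_of_equivariant hF φ M N
      map_smul' := fun r x => by
        rw [M.smul_eq, NatTrans.naturality_apply, ← N.smul_eq]
        rfl }

lemma eq_of_isFlat {F : SingleObj R ⥤ Type w} (hF : IsFlat F) (M N : ModuleStructure F) :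
    M = N := by
  have h := map_add_of_equivariant hF (𝟙 F) M N
  obtain ⟨A, m, hm⟩ := M
  obtain ⟨B, n, hn⟩ := N
  obtain rfl : A = B := AddCommGroup.ext (funext fun a => funext fun b => h a b)
  obtain rfl : m = n := Module.ext' _ _ fun r x => (hm r x).trans (hn r x).symm
  rfl

/-- The module structure on `F(⋆)` transported along an isomorphism from `F` to the functor of a
module `H`. -/
def ofIso {F : SingleObj R ⥤ Type w} {H : Type w} [AddCommGroup H] [Module R H]
    (e : F ≅ actionAsFunctor R H) : ModuleStructure F :=
  let e' : F.obj (SingleObj.star R) ≃ H := (e.app (SingleObj.star R)).toEquiv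
  { addCommGroup := e'.addCommGroup
    module := letI := e'.addCommGroup; e'.module R
    smul_eq := fun r x => by
      let := e'.addCommGroup
      let := e'.module R
      apply e'.injective
      refine (e'.apply_symm_apply (r • e' x)).trans ?_
      exact (NatTrans.naturality_apply e.hom (arrow r) x).symm }

/-- The transported module structure makes `F(⋆)` isomorphic to `H`. -/
def toModuleCatOfIso {F : SingleObj R ⥤ Type w} {H : Type w} [AddCommGroup H] [Module R H]
    (e : F ≅ actionAsFunctor R H) : (ofIso e).toModuleCat ≅ ModuleCat.of R H :=
  let e' : F.obj (SingleObj.star R) ≃ H := (e.app (SingleObj.star R)).toEquiv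
  letI := e'.addCommGroup
  letI := e'.module R
  (e'.linearEquiv R).toModuleIso

end ModuleStructure

/-! ### Flat functors as submodules of the fraction field -/

section Embedding

variable [IsDomain R] {F : SingleObj R ⥤ Type w}

/-- Two elements `q • z` and `q' • z'` are compared through their ratios to a nonzero element
`a₀ = p • z = p' • z'`. No zero element is given beforehand, so that `a₀` being nonzero is expressed
by saying that the arrow `0` moves it. -/
lemma IsFlat.eq_iff_mul_eq_mul (hF : IsFlat F) {a₀ z z' : F.obj (SingleObj.star R)}
    (h₀ : F.map (arrow 0) a₀ ≠ a₀) {p p' q q' : R}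
    (hp : F.map (arrow p) z = a₀) (hp' : F.map (arrow p') z' = a₀) :
    F.map (arrow q) z = F.map (arrow q') z' ↔ q * p' = q' * p := by
  -- Rewrite `z`, `z'` as multiples of one element `w`, then of one `t` for which the two
  -- expressions of `a₀` have the same coefficient.
  obtain ⟨r, r', w, rfl, rfl⟩ := hF.exists_common_arrow z z'
  simp only [← map_arrow_mul] at hp hp' ⊢
  obtain ⟨s, t, rfl, hs⟩ := hF.exists_equalizing_arrow (hp.trans hp'.symm)
  simp only [← map_arrow_mul] at hp hp' ⊢
  have hne : p * r * s ≠ 0 := by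
    intro h
    rw [h] at hp
    exact h₀ (by rw [← hp, ← map_arrow_mul, zero_mul])
  have hne' : p' * r' * s ≠ 0 := hs ▸ hne
  simp only [mul_ne_zero_iff] at hne hne'
  constructor
  · intro h
    obtain ⟨k, y, rfl, hk⟩ := hF.exists_equalizing_arrow h
    have hk₀ : k ≠ 0 := by
      rintro rfl
      rw [← map_arrow_mul, mul_zero] at hp
      exact h₀ (by rw [← hp, ← map_arrow_mul, zero_mul])
    have hk' := mul_right_cancel₀ hk₀ hk
    apply mul_right_cancel₀ (mul_ne_zero (mul_ne_zero hne.1.2 hne'.1.2) (mul_ne_zero hne.2 hne.2))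
    linear_combination (p' * r' * s) * hk' - (q' * r' * s) * hs
  · intro h
    suffices q * r * s = q' * r' * s by rw [this]
    apply mul_right_cancel₀ (mul_ne_zero hne.1.1 hne'.1.1)
    linear_combination (p * r * s) * h + q' * p * hs

variable (K : Type w) [Field K] [Algebra R K] [IsFractionRing R K]

/-- A flat functor embeds in `K`: after fixing a nonzero element `a₀`, an element `a` is sent to the
fraction `q / p`, where `a₀ = p • z` and `a = q • z`. -/
theorem IsFlat.exists_iso_submodule (hF : IsFlat F) :
    ∃ H : Submodule R K, Nonempty (F ≅ (SubmoduleCat.toFunctor R K).obj H) := by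
  -- An injective equivariant map to `K` whose range happens to be a submodule is enough: the range
  -- carries the addition, so that none needs to be defined on `F(⋆)` beforehand.
  suffices ∃ g : F.obj (SingleObj.star R) → K, Function.Injective g ∧
      (∀ r x, g (F.map (arrow r) x) = r • g x) ∧ ∃ H : Submodule R K, (H : Set K) = Set.range g by
    obtain ⟨g, hg, hgr, H, hH⟩ := this
    let e : F.obj (SingleObj.star R) ≃ H :=
      (Equiv.ofInjective g hg).trans (Equiv.setCongr hH.symm)
    exact ⟨H, ⟨NatIso.ofComponents (fun _ => e.toIso) fun {_ _} r => by
      ext x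
      exact Subtype.ext (hgr r x)⟩⟩
  -- If the arrow `0` fixes every element, then `F(⋆)` is a singleton and `H = 0`.
  by_cases h : ∀ a : F.obj (SingleObj.star R), F.map (arrow 0) a = a
  · have hs (a b : F.obj (SingleObj.star R)) : a = b := by
      obtain ⟨p, q, z, rfl, rfl⟩ := hF.exists_common_arrow a b
      rw [← h (F.map (arrow p) z), ← h (F.map (arrow q) z), ← map_arrow_mul, ← map_arrow_mul,
        zero_mul, zero_mul]
    obtain ⟨A, ⟨a⟩⟩ := hF.nonempty
    have : Nonempty (F.obj (SingleObj.star R)) := ⟨a⟩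
    exact ⟨fun _ => 0, fun a b _ => hs a b, fun r x => (smul_zero r).symm, ⊥, by simp⟩
  push Not at h
  obtain ⟨a₀, h₀⟩ := h
  choose p q z hp hq using hF.exists_common_arrow a₀
  have hinj := FaithfulSMul.algebraMap_injective R K
  have hne {p : R} {z : F.obj (SingleObj.star R)} (hp : F.map (arrow p) z = a₀) :
      algebraMap R K p ≠ 0 := by
    rw [map_ne_zero_iff _ hinj]
    rintro rfl
    exact h₀ (by rw [← hp, ← map_arrow_mul, zero_mul])
  let g (a : F.obj (SingleObj.star R)) : K := algebraMap R K (q a) / algebraMap R K (p a)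
  have hg {p' : R} (q' : R) {z' : F.obj (SingleObj.star R)} (hp' : F.map (arrow p') z' = a₀) :
      g (F.map (arrow q') z') = algebraMap R K q' / algebraMap R K p' := by
    rw [div_eq_div_iff (hne (hp _)) (hne hp'), ← map_mul, ← map_mul]
    exact congrArg _ ((hF.eq_iff_mul_eq_mul h₀ (hp _) hp').1 (hq _))
  have hgr (r : R) (x : F.obj (SingleObj.star R)) : g (F.map (arrow r) x) = r • g x := by
    obtain ⟨p', q', z', hp', rfl⟩ := hF.exists_common_arrow a₀ x
    rw [← map_arrow_mul, hg _ hp', hg _ hp', map_mul, Algebra.smul_def, mul_div_assoc]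
  refine ⟨g, fun a b hab => ?_, hgr, ⟨⟨⟨Set.range g, ?_⟩, ⟨F.map (arrow 0) a₀, ?_⟩⟩, ?_⟩, rfl⟩
  · rw [div_eq_div_iff (hne (hp _)) (hne (hp _)), ← map_mul, ← map_mul] at hab
    rw [← hq a, ← hq b, hF.eq_iff_mul_eq_mul h₀ (hp a) (hp b)]
    exact hinj hab
  · rintro _ _ ⟨a, rfl⟩ ⟨b, rfl⟩
    -- Bring the two fractions to the common denominator `p'`.
    obtain ⟨q₁, q₂, y, rfl, rfl⟩ := hF.exists_common_arrow a b
    obtain ⟨p', s, w, hw, rfl⟩ := hF.exists_common_arrow a₀ y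
    refine ⟨F.map (arrow ((q₁ + q₂) * s)) w, ?_⟩
    rw [← map_arrow_mul, ← map_arrow_mul, hg _ hw, hg _ hw, hg _ hw, add_mul, map_add, add_div]
  · rw [hgr, zero_smul]
  · rintro r _ ⟨x, rfl⟩
    exact ⟨_, hgr r x⟩

end Embedding

section Submodules

variable {K : Type w} [Field K] [Algebra R K] [IsFractionRing R K]

/-- In the fraction field of a Bézout domain, two elements of a submodule are multiples of a third:
after clearing denominators this says that an ideal with two generators is principal. -/
lemma _root_.Submodule.exists_smul_eq_smul_eq [IsDomain R] [IsBezout R] (H : Submodule R K)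
    {a b : K} (ha : a ∈ H) (hb : b ∈ H) : ∃ (p q : R), ∃ z ∈ H, p • z = a ∧ q • z = b := by
  obtain ⟨x, y, d, rfl, rfl⟩ : ∃ x y d : R,
      algebraMap R K x / algebraMap R K d = a ∧ algebraMap R K y / algebraMap R K d = b := by
    obtain ⟨x, d, hd, rfl⟩ := IsFractionRing.div_surjective (A := R) a
    obtain ⟨y, e, he, rfl⟩ := IsFractionRing.div_surjective (A := R) b
    refine ⟨x * e, y * d, d * e, ?_, ?_⟩
    · rw [map_mul, map_mul,
        mul_div_mul_right _ _ (IsFractionRing.to_map_ne_zero_of_mem_nonZeroDivisors he)]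
    · rw [map_mul, map_mul, mul_comm (algebraMap R K d),
        mul_div_mul_right _ _ (IsFractionRing.to_map_ne_zero_of_mem_nonZeroDivisors hd)]
  obtain ⟨c, hc⟩ := (IsBezout.span_pair_isPrincipal x y).principal
  rw [← Ideal.span] at hc
  have hcm : c ∈ Ideal.span {x, y} := hc ▸ Ideal.mem_span_singleton_self c
  have hxm : x ∈ Ideal.span {c} := hc ▸ Ideal.subset_span (by simp)
  have hym : y ∈ Ideal.span {c} := hc ▸ Ideal.subset_span (by simp)
  obtain ⟨α, β, hαβ⟩ := Ideal.mem_span_pair.1 hcm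
  obtain ⟨p, rfl⟩ := Ideal.mem_span_singleton'.1 hxm
  obtain ⟨q, rfl⟩ := Ideal.mem_span_singleton'.1 hym
  refine ⟨p, q, algebraMap R K c / algebraMap R K d, ?_, ?_, ?_⟩
  · have := H.add_mem (H.smul_mem α ha) (H.smul_mem β hb)
    rwa [Algebra.smul_def, Algebra.smul_def, ← mul_div_assoc, ← mul_div_assoc, ← add_div,
      ← map_mul, ← map_mul, ← map_add, hαβ] at this
  · rw [Algebra.smul_def, map_mul, mul_div_assoc]
  · rw [Algebra.smul_def, map_mul, mul_div_assoc]

theorem SubmoduleCat.isFlat [IsDomain R] [IsBezout R] (H : SubmoduleCat R K) :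
    IsFlat ((SubmoduleCat.toFunctor R K).obj H) where
  nonempty := ⟨SingleObj.star R, ⟨(0 : (H : Submodule R K))⟩⟩
  exists_common := by
    rintro _ _ (⟨a, ha⟩ : (H : Submodule R K)) (⟨b, hb⟩ : (H : Submodule R K))
    obtain ⟨p, q, z, hz, hp, hq⟩ := Submodule.exists_smul_eq_smul_eq H ha hb
    exact ⟨SingleObj.star R, arrow p, arrow q, (⟨z, hz⟩ : (H : Submodule R K)),
      Subtype.ext hp, Subtype.ext hq⟩
  exists_equalizing := by
    rintro _ _ (p : R) (q : R) (a : (H : Submodule R K)) (h : p • a = q • a)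
    by_cases ha : a = 0
    · subst ha
      refine ⟨SingleObj.star R, arrow 0, (0 : (H : Submodule R K)),
        smul_zero (A := (H : Submodule R K)) (0 : R), ?_⟩
      exact (mul_zero p).trans (mul_zero q).symm
    · refine ⟨SingleObj.star R, arrow 1, a, one_smul R a, ?_⟩
      have := Module.IsTorsionFree.trans_faithfulSMul R K K
      obtain rfl : p = q := smul_left_injective R ha h
      rfl

end Submodules

variable {M : Type w} [AddCommGroup M] [Module R M]

/-- The evident module structure on the functor of a submodule. -/
def SubmoduleCat.moduleStructure (H : SubmoduleCat R M) :
    ModuleStructure ((SubmoduleCat.toFunctor R M).obj H) where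
  addCommGroup := inferInstanceAs (AddCommGroup (H : Submodule R M))
  module := inferInstanceAs (Module R (H : Submodule R M))
  smul_eq _ _ := rfl

instance : (SubmoduleCat.toFunctor R M).Faithful where
  map_injective {H H'} f g h := by
    refine InducedCategory.hom_ext (ModuleCat.hom_ext (LinearMap.ext fun x => ?_))
    exact ConcreteCategory.congr_hom (congr_app h (SingleObj.star R)) x

lemma SubmoduleCat.full_toFunctor
    (h : ∀ H, IsFlat ((SubmoduleCat.toFunctor R M).obj H)) :
    (SubmoduleCat.toFunctor R M).Full where
  map_surjective {H H'} φ :=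
    ⟨⟨ModuleStructure.homOfNatTrans (h H) φ H.moduleStructure H'.moduleStructure⟩, rfl⟩

/-- Over a Bézout domain, the flat functors are the functors of the submodules of the fraction
field. -/
instance [IsDomain R] [IsBezout R] (K : Type w) [Field K] [Algebra R K] [IsFractionRing R K] :
    ((flatFunctors _).lift (SubmoduleCat.toFunctor R K) SubmoduleCat.isFlat).IsEquivalence where
  faithful := inferInstance
  full :=
    have := SubmoduleCat.full_toFunctor (R := R) (M := K) SubmoduleCat.isFlat
    inferInstance
  essSurj := ⟨fun F =>
    let ⟨H, ⟨e⟩⟩ := F.property.exists_iso_submodule K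
    ⟨H, ⟨(flatFunctors _).ι.preimageIso e.symm⟩⟩⟩

end Ring

end ArithTopos

theorem mainTheorem1 (K : Type u) [Field K] [NumberField K] [IsPrincipalIdealRing (𝓞 K)] :
    -- every flat functor `F` carries exactly one module structure on `F(⋆)` over `𝓞 K`
    (∀ F : SingleObj (𝓞 K) ⥤ Type u, ArithTopos.IsFlat F →
      ∃ M : ArithTopos.ModuleStructure F,
        -- it is the only one
        (∀ M' : ArithTopos.ModuleStructure F, M' = M) ∧
        -- it is isomorphic to a submodule of `K`
        (∃ H : Submodule (𝓞 K) K, Nonempty (M.toModuleCat ≅ ModuleCat.of (𝓞 K) H))) ∧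
    -- natural transformations between flat functors are linear
    (∀ F G : SingleObj (𝓞 K) ⥤ Type u, ArithTopos.IsFlat F → ArithTopos.IsFlat G →
      ∀ (M : ArithTopos.ModuleStructure F) (N : ArithTopos.ModuleStructure G) (φ : F ⟶ G),
        ∃ f : M.toModuleCat ⟶ N.toModuleCat,
          ∀ x : F.obj (SingleObj.star (𝓞 K)), f.hom x = φ.app (SingleObj.star (𝓞 K)) x) ∧
    -- the canonical equivalence between the points and the submodules of `K`
    (∃ e : ArithTopos.Points.{u} (SingleObj (𝓞 K)) ≌ ArithTopos.SubmoduleCat (𝓞 K) K,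
      Nonempty (e.functor ⋙ ArithTopos.SubmoduleCat.toFunctor (𝓞 K) K ≅
        ArithTopos.Points.toFunctor (SingleObj (𝓞 K)))) := by
  refine ⟨fun F hF => ?_, fun F G hF hG M N φ =>
    ⟨ArithTopos.ModuleStructure.homOfNatTrans hF φ M N, fun x => rfl⟩, ?_⟩
  · obtain ⟨H, ⟨e⟩⟩ := hF.exists_iso_submodule K
    exact ⟨.ofIso e, fun M' => ArithTopos.ModuleStructure.eq_of_isFlat hF _ _, H,
      ⟨ArithTopos.ModuleStructure.toModuleCatOfIso e⟩⟩
  · let P := ArithTopos.flatFunctors.{u} (SingleObj (𝓞 K))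
    let E₁ := (P.lift (ArithTopos.Points.toFunctor _) ArithTopos.Points.isFlat).asEquivalence
    let E₂ := (P.lift (ArithTopos.SubmoduleCat.toFunctor (𝓞 K) K)
      ArithTopos.SubmoduleCat.isFlat).asEquivalence
    exact ⟨E₁.trans E₂.symm, ⟨Functor.isoWhiskerRight
      (Functor.isoWhiskerLeft E₁.functor E₂.counitIso) P.ι⟩⟩
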